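/- Let $A_2=\mathbb{C}[t_1,t_2]$, $\partial_i=\partial/\partial t_i$, and let $\bar S_2$ be the Lie algebra of all derivations $D=p_1\partial_1+p_2\partial_2$ of $A_2$ ($p_1,p_2\in A_2$) with constant divergence, i.e. $\partial_1(p_1)+\partial_2(p_2)\in\mathbb{C}$. Let $\Delta_2=\mathrm{span}\{\partial_1,\partial_2\}\subset\bar S_2$, and let $\widetilde S_2=\bar S_2\ltimes A_2$ be the semidirect product, where $A_2$ is an abelian ideal on which $\bar S_2$ acts by derivations. An $(A_2,\bar S_2)$-module is an $\widetilde S_2$-module $M$ on which $A_2$ acts associatively: $f(gv)=(fg)v$ and $1v=v$ for all $f,g\in A_2$, $v\in M$. It is a Whittaker module if $\Delta_2$ acts locally finitely on it. For $\mathbf a=(a_1,a_2)\in\mathbb{C}^2$ let $\phi_{\mathbf a}:\Delta_2\to\mathbb{C}$ be the homomorphism with $\phi_{\mathbf a}(\partial_i)=a_i$; a Whittaker module $M$ is of type $\phi_{\mathbf a}$ if for every $v\in M$ and $x\in\Delta_2$ there is a $k$ with $(x-\phi_{\mathbf a}(x))^kv=0$. Put $\mathrm{Wh}_{\mathbf a}(M)=\{v\in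 M : xv=\phi_{\mathbf a}(x)v \text{ for all } x\in\Delta_2\}$. For a $\mathfrak{gl}_2(\mathbb{C})$-module $V$, let $T(A_2^{\mathbf a},V)$ be the $(A_2,\bar S_2)$-module with underlying space $A_2\otimes V$ and action $$D(p\otimes v)=\big(D(p)+(a_1p_1+a_2p_2)p\big)\otimes v+\sum_{i,j=1}^{2}\partial_j(p_i)\,p\otimes E_{ji}v,\qquad f(p\otimes v)=(fp)\otimes v,$$ for $D=p_1\partial_1+p_2\partial_2\in\bar S_2$, $f,p\in A_2$, $v\in V$, where $E_{ji}$ are the matrix units. If $\mathbf a\in\mathbb{C}^2$ and $M$ is a simple Whittaker $(A_2,\bar S_2)$-module of type $\phi_{\mathbf a}$ with $\dim\mathrm{Wh}_{\mathbf a}(M)<\infty$, then there is a simple finite-dimensional $\mathfrak{gl}_2(\mathbb{C})$-module $V$ such that $M\cong T(A_2^{\mathbf a},V)$ as $(A_2,\bar S_2)$-modules. -/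

import Mathlib

open scoped TensorProduct

universe u

/- The commutator bracket on an associative ring. It is used for `gl₂` and endomorphism algebras;
on the commutative ring `ℂ[t₁, t₂]` and on `ℂ` it is the zero bracket. -/
attribute [local instance] LieRing.ofAssociativeRing

noncomputable section

namespace CartanS

/-! ### The Lie algebras -/

/-- The polynomial algebra `A₂ = ℂ[t₁, t₂]` (indices `0, 1 : Fin 2` stand for `1, 2`). -/
abbrev A₂ : Type := MvPolynomial (Fin 2) ℂ

/-- The Witt algebra `W₂` of all derivations of `A₂`, with the commutator bracket. A derivation
`D` is the vector field `∑ i, D tᵢ • ∂ᵢ`. -/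
abbrev W₂ : Type := Derivation ℂ A₂ A₂

/-- The Lie algebra `gl₂` of complex `2 × 2` matrices with the commutator bracket. -/
abbrev gl₂ : Type := Matrix (Fin 2) (Fin 2) ℂ

/-- The divergence `∑ i, ∂ᵢ (pᵢ)` of the vector field `D = ∑ i, pᵢ ∂ᵢ`, where `pᵢ = D tᵢ`. -/
def divergence : W₂ →ₗ[ℂ] A₂ where
  toFun D := ∑ i, MvPolynomial.pderiv i (D (MvPolynomial.X i))
  map_add' D E := by simp [Finset.sum_add_distrib]
  map_smul' c D := by simp

theorem apply_eq_sum (D : W₂) (f : A₂) :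
    D f = ∑ k, D (MvPolynomial.X k) * MvPolynomial.pderiv k f := by
  have h : D = ∑ k, D (MvPolynomial.X k) • (MvPolynomial.pderiv k : W₂) := by
    ext i
    simp [MvPolynomial.pderiv_X, Pi.single_apply, Fin.sum_univ_two]
    fin_cases i <;> simp
  conv_lhs => rw [h]
  simp [Fin.sum_univ_two]

theorem pderiv_comm (i j : Fin 2) (f : A₂) :
    MvPolynomial.pderiv i (MvPolynomial.pderiv j f)
      = MvPolynomial.pderiv j (MvPolynomial.pderiv i f) := by
  have h : ⁅(MvPolynomial.pderiv i : W₂), (MvPolynomial.pderiv j : W₂)⁆ = 0 := by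
    ext k
    simp [Derivation.commutator_apply, MvPolynomial.pderiv_X, Pi.single_apply, apply_ite]
  have := congrArg (fun D : W₂ => D f) h
  simpa [Derivation.commutator_apply, sub_eq_zero] using this

theorem pderiv_apply (j : Fin 2) (D : W₂) (f : A₂) :
    MvPolynomial.pderiv j (D f) = D (MvPolynomial.pderiv j f)
      + ∑ k, MvPolynomial.pderiv j (D (MvPolynomial.X k)) * MvPolynomial.pderiv k f := by
  rw [apply_eq_sum D f, apply_eq_sum D (MvPolynomial.pderiv j f)]
  simp only [Fin.sum_univ_two, map_add, Derivation.leibniz, smul_eq_mul, pderiv_comm j]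
  ring

theorem divergence_lie (D E : W₂) :
    divergence ⁅D, E⁆ = D (divergence E) - E (divergence D) := by
  simp only [divergence, LinearMap.coe_mk, AddHom.coe_mk, Derivation.commutator_apply, map_sub]
  simp only [pderiv_apply _ D (E _), pderiv_apply _ E (D _), Fin.sum_univ_two, map_add]
  ring

/-- The Lie algebra `S̄₂` of polynomial vector fields on `ℂ²` with constant divergence. -/
def SBar : LieSubalgebra ℂ W₂ where
  carrier := {D | ∃ c : ℂ, divergence D = MvPolynomial.C c}
  add_mem' := by
    rintro D E ⟨c, hc⟩ ⟨d, hd⟩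
    exact ⟨c + d, by simp [hc, hd]⟩
  zero_mem' := ⟨0, by simp⟩
  smul_mem' := by
    rintro r D ⟨c, hc⟩
    exact ⟨r * c, by simp [hc, MvPolynomial.smul_eq_C_mul]⟩
  lie_mem' := by
    rintro D E ⟨c, hc⟩ ⟨d, hd⟩
    exact ⟨0, by simp [divergence_lie, hc, hd, MvPolynomial.derivation_C]⟩

/-- The action of `S̄₂` on the abelian Lie algebra `A₂` by derivations. -/
def derAction : SBar →ₗ⁅ℂ⁆ LieDerivation ℂ A₂ A₂ where
  toFun D :=
    { toLinearMap := (D : W₂).toLinearMap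
      leibniz' := fun f g => by
        simp [LieRing.of_associative_ring_bracket, mul_comm] }
  map_add' D E := by ext; rfl
  map_smul' c D := by ext; rfl
  map_lie' := by intro D E; ext f; rfl

/-- The semidirect product Lie algebra `S̃₂ = S̄₂ ⋉ A₂`, where `A₂` is an abelian ideal on which
`S̄₂` acts by derivations. -/
abbrev STilde : Type := LieAlgebra.SemiDirectSum A₂ SBar derAction

/-- The inclusion `A₂ → S̃₂`. -/
abbrev ofA : A₂ →ₗ⁅ℂ⁆ STilde := LieAlgebra.SemiDirectSum.inl derAction

/-- The inclusion `S̄₂ → S̃₂`. -/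
abbrev ofS : SBar →ₗ⁅ℂ⁆ STilde := LieAlgebra.SemiDirectSum.inr derAction

/-- The element `∂ᵢ` of `S̄₂`. -/
def partialS (i : Fin 2) : SBar :=
  ⟨MvPolynomial.pderiv i, 0, by
    simp [divergence, MvPolynomial.pderiv_X, Pi.single_apply, apply_ite]⟩

theorem partialS_lie (i j : Fin 2) : ⁅partialS i, partialS j⁆ = 0 := by
  apply Subtype.ext
  ext k
  simp [partialS, Derivation.commutator_apply, MvPolynomial.pderiv_X, Pi.single_apply, apply_ite]

theorem span_partialS_lie {x y : SBar}
    (hx : x ∈ Submodule.span ℂ (Set.range partialS))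
    (hy : y ∈ Submodule.span ℂ (Set.range partialS)) : ⁅x, y⁆ = 0 := by
  induction hx, hy using Submodule.span_induction₂ with
  | mem_mem x y hx hy =>
    obtain ⟨i, rfl⟩ := hx
    obtain ⟨j, rfl⟩ := hy
    exact partialS_lie i j
  | zero_left y hy => simp
  | zero_right x hx => simp
  | add_left x y z _ _ _ h1 h2 => simp [h1, h2]
  | add_right x y z _ _ _ h1 h2 => simp [h1, h2]
  | smul_left r x y _ _ h => simp [h]
  | smul_right r x y _ _ h => simp [h]

/-- The abelian subalgebra `Δ₂ = span {∂₁, ∂₂}` of `S̄₂`. -/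
def Delta : LieSubalgebra ℂ SBar :=
  { Submodule.span ℂ (Set.range partialS) with
    lie_mem' := by
      intro x y hx hy
      rw [span_partialS_lie hx hy]
      exact Submodule.zero_mem _ }

/-- The Lie algebra homomorphism `φ_a : Δ₂ → ℂ` with `φ_a (∂ᵢ) = aᵢ`
(the `i`-th coordinate of `x ∈ Δ₂` is the constant polynomial `x tᵢ`). -/
def phi (a : Fin 2 → ℂ) : Delta →ₗ⁅ℂ⁆ ℂ where
  toFun x := ∑ i, a i * MvPolynomial.constantCoeff (((x : SBar) : W₂) (MvPolynomial.X i))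
  map_add' x y := by simp [mul_add, Finset.sum_add_distrib]
  map_smul' c x := by
    simp [MvPolynomial.smul_eq_C_mul]
    ring
  map_lie' := by
    intro x y
    have h : ((⁅x, y⁆ : Delta) : SBar) = 0 := span_partialS_lie x.2 y.2
    rw [LieRing.of_associative_ring_bracket, mul_comm, sub_self, h]
    simp

theorem partialS_mem (i : Fin 2) : partialS i ∈ Delta :=
  Submodule.subset_span ⟨i, rfl⟩

theorem phi_partialS (a : Fin 2 → ℂ) (i : Fin 2) : phi a ⟨partialS i, partialS_mem i⟩ = a i := by
  change ∑ j, a j * MvPolynomial.constantCoeff (MvPolynomial.pderiv i (MvPolynomial.X j)) = a i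
  simp [MvPolynomial.pderiv_X, Pi.single_apply, apply_ite]

/-! ### Whittaker modules over `S̃₂` -/

section Modules

variable (M : Type u) [AddCommGroup M] [Module ℂ M] [LieRingModule STilde M] [LieModule ℂ STilde M]

/-- The operator by which `x ∈ Δ₂` acts on an `S̃₂`-module. -/
def deltaEnd (x : Delta) : Module.End ℂ M := LieModule.toEnd ℂ STilde M (ofS (x : SBar))

/-- An `S̃₂`-module is an `(A₂, S̄₂)`-module if `A₂` acts associatively (and unitally) on it. -/
structure IsASModule : Prop where
  mul_act : ∀ (f g : A₂) (v : M), ⁅ofA f, ⁅ofA g, v⁆⁆ = ⁅ofA (f * g), v⁆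
  one_act : ∀ v : M, ⁅ofA 1, v⁆ = v

/-- `M` is a Whittaker module: `Δ₂` acts locally finitely, i.e. every vector lies in a
finite-dimensional `Δ₂`-stable subspace. -/
def IsWhittaker : Prop :=
  ∀ v : M, ∃ N : Submodule ℂ M, v ∈ N ∧ FiniteDimensional ℂ N ∧
    ∀ x : Delta, ∀ w ∈ N, deltaEnd M x w ∈ N

/-- The Whittaker module `M` is of type `φ_a`, i.e. `M = M(a)`: for all `v` and all `x ∈ Δ₂`, some
power of `x - φ_a(x)` kills `v`. -/
def IsOfType (a : Fin 2 → ℂ) : Prop :=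
  ∀ v : M, ∀ x : Delta, ∃ k : ℕ, ((deltaEnd M x - phi a x • (1 : Module.End ℂ M)) ^ k) v = 0

/-- The space `Wh_a(M)` of Whittaker vectors: `x v = φ_a(x) v` for all `x ∈ Δ₂`. -/
def Wh (a : Fin 2 → ℂ) : Submodule ℂ M where
  carrier := {v | ∀ x : Delta, deltaEnd M x v = phi a x • v}
  add_mem' := by
    intro v w hv hw x
    rw [map_add, hv x, hw x, smul_add]
  zero_mem' := by
    intro x
    rw [map_zero, smul_zero]
  smul_mem' := by
    intro c v hv x
    rw [map_smul, hv x, smul_comm]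

end Modules

/-! ### The modules `T(A₂ᵃ, V)` -/

/-- The action of vector fields on the twisted module `A₂ᵃ`: `tᵢ` acts by multiplication and `∂ᵢ`
by `∂ᵢ + aᵢ`, so that `D = ∑ pᵢ ∂ᵢ` sends `f` to `∑ pᵢ (∂ᵢ + aᵢ) f = D f + (∑ aᵢ pᵢ) f`. -/
def twistedAct (a : Fin 2 → ℂ) : W₂ →ₗ[ℂ] Module.End ℂ A₂ where
  toFun D := D.toLinearMap + LinearMap.mulLeft ℂ (∑ i, a i • D (MvPolynomial.X i))
  map_add' D E := by
    refine LinearMap.ext fun f => ?_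
    simp [Fin.sum_univ_two]
    ring
  map_smul' c D := by
    refine LinearMap.ext fun f => ?_
    simp [Fin.sum_univ_two, MvPolynomial.smul_eq_C_mul]
    ring

/-- The Jacobian matrix of a vector field `D = ∑ pᵢ ∂ᵢ`; its `(j, i)` entry is `∂ⱼ pᵢ`. -/
def jacobian : W₂ →ₗ[ℂ] Matrix (Fin 2) (Fin 2) A₂ where
  toFun D := Matrix.of fun j i => MvPolynomial.pderiv j (D (MvPolynomial.X i))
  map_add' D E := by
    ext j i : 2
    simp
  map_smul' c D := by
    ext j i : 2
    simp

section Tensor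

variable (V : Type u) [AddCommGroup V] [Module ℂ V] [LieRingModule gl₂ V] [LieModule ℂ gl₂ V]

/-- The action of `gl₂(A₂) = A₂ ⊗ gl₂` on `A₂ ⊗ V`: the matrix `G` acts by
`f ⊗ v ↦ ∑ j, ∑ i, G_{ji} f ⊗ E_{ji} v`. -/
def matAct : Matrix (Fin 2) (Fin 2) A₂ →ₗ[ℂ] Module.End ℂ (A₂ ⊗[ℂ] V) where
  toFun G := ∑ j, ∑ i, TensorProduct.map (LinearMap.mulLeft ℂ (G j i))
    (LieModule.toEnd ℂ gl₂ V (Matrix.single j i 1))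
  map_add' G H := by
    refine TensorProduct.ext' fun f v => ?_
    simp [Fin.sum_univ_two, add_mul, TensorProduct.add_tmul]
    abel
  map_smul' c G := by
    refine TensorProduct.ext' fun f v => ?_
    simp [Fin.sum_univ_two, TensorProduct.smul_tmul', smul_add]

/-- The operator by which `(D, f) ∈ S̄₂ ⋉ A₂` acts on `T(A₂ᵃ, V) = A₂ᵃ ⊗ V`. For `D = ∑ pᵢ ∂ᵢ`,
`(D, f) (p ⊗ v) = (D p + ∑ aᵢ pᵢ p) ⊗ v + ∑ j, ∑ i, (∂ⱼ pᵢ) p ⊗ E_{ji} v + (f p) ⊗ v`. -/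
def tensorAct (a : Fin 2 → ℂ) : STilde →ₗ[ℂ] Module.End ℂ (A₂ ⊗[ℂ] V) where
  toFun x := TensorProduct.map (twistedAct a (x.right : W₂)) LinearMap.id
    + matAct V (jacobian (x.right : W₂))
    + TensorProduct.map (LinearMap.mulLeft ℂ x.left) LinearMap.id
  map_add' x y := by
    refine TensorProduct.ext' fun p v => ?_
    simp [add_mul, TensorProduct.add_tmul]
    abel
  map_smul' c x := by
    refine TensorProduct.ext' fun p v => ?_
    simp [TensorProduct.smul_tmul']

theorem twistedAct_lie (a : Fin 2 → ℂ) (D E : W₂) (p : A₂) :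
    twistedAct a ⁅D, E⁆ p
      = twistedAct a D (twistedAct a E p) - twistedAct a E (twistedAct a D p) := by
  have h : ∀ (D : W₂) (q : A₂), twistedAct a D q
      = D q + (∑ i, a i • D (MvPolynomial.X i)) * q := fun _ _ => rfl
  simp only [h, Derivation.commutator_apply, Fin.sum_univ_two, MvPolynomial.smul_eq_C_mul,
    map_add, Derivation.leibniz, smul_eq_mul, MvPolynomial.derivation_C]
  ring

theorem twistedAct_mul (a : Fin 2 → ℂ) (D : W₂) (g p : A₂) :
    twistedAct a D (g * p) = D g * p + g * twistedAct a D p := by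
  simp [twistedAct]
  ring

theorem jacobian_lie (D E : W₂) :
    jacobian ⁅D, E⁆ = (jacobian E).map D - (jacobian D).map E
      + (jacobian D * jacobian E - jacobian E * jacobian D) := by
  refine Matrix.ext fun j i => ?_
  simp only [jacobian, LinearMap.coe_mk, AddHom.coe_mk, Matrix.of_apply, Matrix.add_apply,
    Matrix.sub_apply, Matrix.map_apply, Matrix.mul_apply, Fin.sum_univ_two,
    Derivation.commutator_apply, map_sub]
  rw [pderiv_apply _ D (E _), pderiv_apply _ E (D _)]
  simp only [Fin.sum_univ_two]
  ring

theorem matAct_tmul (G : Matrix (Fin 2) (Fin 2) A₂) (p : A₂) (v : V) :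
    matAct V G (p ⊗ₜ v) = ∑ j, ∑ i, (G j i * p) ⊗ₜ ⁅(Matrix.single j i 1 : gl₂), v⁆ := by
  simp [matAct]

theorem matAct_lie (G H : Matrix (Fin 2) (Fin 2) A₂) :
    matAct V (G * H - H * G) = matAct V G * matAct V H - matAct V H * matAct V G := by
  have key : ∀ j i l k : Fin 2, ∀ v : V,
      ⁅(Matrix.single j i 1 : gl₂), ⁅(Matrix.single l k 1 : gl₂), v⁆⁆
        = ⁅(Matrix.single l k 1 : gl₂), ⁅(Matrix.single j i 1 : gl₂), v⁆⁆
          + ((if i = l then ⁅(Matrix.single j k 1 : gl₂), v⁆ else 0)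
          - (if k = j then ⁅(Matrix.single l i 1 : gl₂), v⁆ else 0)) := by
    intro j i l k v
    have h := lie_lie (Matrix.single j i (1 : ℂ) : gl₂) (Matrix.single l k (1 : ℂ) : gl₂) v
    rw [← sub_eq_iff_eq_add', ← h, LieRing.of_associative_ring_bracket, sub_lie]
    congr 1
    · split_ifs with hh
      · subst hh; simp
      · simp [hh]
    · split_ifs with hh
      · subst hh; simp
      · simp [hh]
  refine TensorProduct.ext' fun p v => ?_
  simp only [LinearMap.sub_apply, Module.End.mul_apply, matAct_tmul, Fin.sum_univ_two,
    map_add, Matrix.sub_apply, Matrix.mul_apply]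
  simp only [mul_left_comm (H _ _) (G _ _) p]
  simp only [key 0 0 0 1, key 0 0 1 0, key 0 0 1 1, key 0 1 1 0, key 0 1 1 1, key 1 0 1 1,
    if_true, one_ne_zero, zero_ne_one, if_false, TensorProduct.tmul_add, TensorProduct.tmul_sub,
    TensorProduct.tmul_zero, add_mul, sub_mul, TensorProduct.add_tmul, TensorProduct.sub_tmul,
    mul_assoc, mul_left_comm (H _ _) (G _ _) p]
  abel

theorem tensorAct_lie (a : Fin 2 → ℂ) (x y : STilde) :
    tensorAct V a ⁅x, y⁆
      = tensorAct V a x * tensorAct V a y - tensorAct V a y * tensorAct V a x := by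
  obtain ⟨f, D⟩ := x
  obtain ⟨g, E⟩ := y
  refine TensorProduct.ext' fun p v => ?_
  have h : ∀ (f : A₂) (D : SBar) (p : A₂) (v : V), tensorAct V a ⟨f, D⟩ (p ⊗ₜ v)
      = twistedAct a (D : W₂) p ⊗ₜ v + matAct V (jacobian (D : W₂)) (p ⊗ₜ v)
        + (f * p) ⊗ₜ v := fun _ _ _ _ => rfl
  have hb : ⁅(⟨f, D⟩ : STilde), (⟨g, E⟩ : STilde)⁆
      = ⟨(D : W₂) g - (E : W₂) f, ⁅D, E⁆⟩ := by
    rw [LieAlgebra.SemiDirectSum.lie_eq_mk, LieRing.of_associative_ring_bracket, mul_comm, sub_self,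
      zero_add]
    rfl
  have hm := congrArg (fun T : Module.End ℂ (A₂ ⊗[ℂ] V) => T (p ⊗ₜ v))
    (matAct_lie V (jacobian (D : W₂)) (jacobian (E : W₂)))
  simp only [LinearMap.sub_apply, Module.End.mul_apply] at hm
  rw [hb, h, LieSubalgebra.coe_bracket, jacobian_lie, map_add, LinearMap.add_apply, hm,
    twistedAct_lie]
  simp only [LinearMap.sub_apply, Module.End.mul_apply, h, map_add]
  simp only [matAct_tmul, map_sub, LinearMap.sub_apply, map_add, h, Fin.sum_univ_two,
    twistedAct_mul, Matrix.map_apply, TensorProduct.add_tmul, TensorProduct.sub_tmul, sub_mul]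
  simp only [mul_left_comm f (jacobian _ _ _) p, mul_left_comm g (jacobian _ _ _) p,
    mul_left_comm g f p]
  abel

/-- The underlying vector space `A₂ᵃ ⊗ V` of the module `T(A₂ᵃ, V)`. -/
def T (_a : Fin 2 → ℂ) (V : Type u) [AddCommGroup V] [Module ℂ V] : Type u := A₂ ⊗[ℂ] V

instance (a : Fin 2 → ℂ) : AddCommGroup (T a V) := inferInstanceAs (AddCommGroup (A₂ ⊗[ℂ] V))

instance (a : Fin 2 → ℂ) : Module ℂ (T a V) := inferInstanceAs (Module ℂ (A₂ ⊗[ℂ] V))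

/-- The `S̃₂`-module `T(A₂ᵃ, V)`, with the action `tensorAct`. -/
instance (a : Fin 2 → ℂ) : LieRingModule STilde (T a V) where
  bracket x w := tensorAct V a x w
  add_lie x y w := LinearMap.congr_fun ((tensorAct V a).map_add x y) w
  lie_add x w w' := (tensorAct V a x).map_add w w'
  leibniz_lie x y w :=
    (eq_sub_iff_add_eq.mp (LinearMap.congr_fun (tensorAct_lie V a x y) w)).symm

instance (a : Fin 2 → ℂ) : LieModule ℂ STilde (T a V) where
  smul_lie c x w := LinearMap.congr_fun ((tensorAct V a).map_smul c x) w
  lie_smul c x w := (tensorAct V a x).map_smul c w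

end Tensor

end CartanS

end

/-!
The operators `tᵢ` and the locally nilpotent operators `∂ᵢ - aᵢ` satisfy the relations of the Weyl
algebra, so that `M = Wh_a(M) ⊕ 𝔪M`, where `𝔪` is the maximal ideal of the origin; in particular
the Whittaker vectors form the fibre `M / 𝔪M`, and a subspace of `𝔪M` stable under the `∂ᵢ - aᵢ`
vanishes, since it contains no nonzero Whittaker vector.

The vector fields vanishing at the origin act on the fibre. An eigenvector of the Euler field whose
eigenvalue has maximal real part is killed by the fields without constant and linear terms, because
these raise Euler eigenvalues. The vectors with this property thus form a nonzero module over the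
linear fields, i.e. over `gl₂`, and it contains a simple submodule `V`.

Let `s v` be the Whittaker vector representing `v ∈ V`. The map `p ⊗ v ↦ p (s v)` from
`T(A₂ᵃ, V)` to `M` commutes with the vector fields: for fixed `v`, its defects of equivariance at
`1 ⊗ v` form a subspace of `𝔪M` stable under the `∂ᵢ - aᵢ`. It is injective since it is so on
Whittaker vectors, and surjective since `M` is simple.
-/

noncomputable section

namespace CartanS

section Weyl

open Module.End

theorem pow_succ_mul_of_mul_eq {A : Type*} [Semiring A] {d t : A} (h : d * t = t * d + 1) (n : ℕ) :
    d ^ (n + 1) * t = t * d ^ (n + 1) + (n + 1 : ℕ) • d ^ n := by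
  induction n with
  | zero => simpa using h
  | succ n ih =>
    rw [pow_succ' d (n + 1), mul_assoc, ih, mul_add, ← mul_assoc, h, add_mul, one_mul, mul_assoc,
      mul_smul_comm, ← pow_succ', ← pow_succ', succ_nsmul _ (n + 1), add_assoc,
      add_comm (d ^ (n + 1))]

variable {R M : Type*} [Ring R] [AddCommGroup M] [Module R M]

theorem eq_bot_of_disjoint_ker {d : Module.End R M} (hd : ∀ x, ∃ n : ℕ, (d ^ n) x = 0)
    {N : Submodule R M} (hN : N ∈ d.invtSubmodule) (h : Disjoint N (LinearMap.ker d)) : N = ⊥ := by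
  refine N.eq_bot_iff.mpr fun x hx => ?_
  obtain ⟨n, hn⟩ := hd x
  induction n generalizing x with
  | zero => simpa using hn
  | succ n ih =>
    refine Submodule.disjoint_def.mp h x hx (ih (d x) (hN hx) ?_)
    rwa [← Module.End.mul_apply, ← pow_succ]

theorem ker_mem_invtSubmodule {f g : Module.End R M} (h : Commute f g) :
    LinearMap.ker g ∈ f.invtSubmodule := by
  intro x hx
  rw [Submodule.mem_comap, LinearMap.mem_ker, ← Module.End.mul_apply, ← h.eq,
    Module.End.mul_apply, LinearMap.mem_ker.mp hx, map_zero]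

theorem range_mem_invtSubmodule {f g : Module.End R M} (h : Commute f g) :
    LinearMap.range g ∈ f.invtSubmodule := by
  rintro _ ⟨x, rfl⟩
  exact ⟨f x, LinearMap.congr_fun h.eq.symm x⟩

variable {ι : Type*}

theorem finsetInf_ker_mem_invtSubmodule {f : Module.End R M} {d : ι → Module.End R M}
    {s : Finset ι} (h : ∀ i ∈ s, Commute f (d i)) :
    (s.inf fun i => LinearMap.ker (d i)) ∈ f.invtSubmodule :=
  Finset.inf_induction (invtSubmodule.top_mem f) (fun _ hp _ hq => invtSubmodule.inf_mem hp hq)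
    fun i hi => ker_mem_invtSubmodule (h i hi)

theorem finsetSup_range_mem_invtSubmodule {f : Module.End R M} {t : ι → Module.End R M}
    {s : Finset ι} (h : ∀ i ∈ s, Commute f (t i)) :
    (s.sup fun i => LinearMap.range (t i)) ∈ f.invtSubmodule :=
  Finset.sup_induction (invtSubmodule.bot_mem f) (fun _ hp _ hq => invtSubmodule.sup_mem hp hq)
    fun i hi => range_mem_invtSubmodule (h i hi)

theorem eq_bot_of_disjoint_finsetInf_ker {d : ι → Module.End R M}
    (hcomm : ∀ i j, Commute (d i) (d j)) (hd : ∀ i x, ∃ n : ℕ, (d i ^ n) x = 0) (s : Finset ι)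
    {N : Submodule R M} (hN : ∀ i, N ∈ (d i).invtSubmodule)
    (h : Disjoint N (s.inf fun i => LinearMap.ker (d i))) : N = ⊥ := by
  induction s using Finset.cons_induction with
  | empty => simpa using h
  | cons j s _ ih =>
    rw [Finset.inf_cons, inf_comm, ← disjoint_assoc] at h
    have hstable := finsetInf_ker_mem_invtSubmodule (s := s) fun i _ => hcomm j i
    exact ih (disjoint_iff.mpr
      (eq_bot_of_disjoint_ker (hd j) (invtSubmodule.inf_mem (hN j) hstable) h))

variable {K M : Type*} [DivisionRing K] [CharZero K] [AddCommGroup M] [Module K M]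
  {d t : Module.End K M}

theorem disjoint_ker_range (h : d * t = t * d + 1) (hd : ∀ x, ∃ n : ℕ, (d ^ n) x = 0) :
    Disjoint (LinearMap.ker d) (LinearMap.range t) := by
  rw [Submodule.disjoint_def]
  rintro _ hx ⟨x, rfl⟩
  suffices x = 0 by rw [this, map_zero]
  obtain ⟨n, hn⟩ := hd x
  induction n with
  | zero => simpa using hn
  | succ n ih =>
    have key : (d ^ (n + 1)) (t x) = t ((d ^ (n + 1)) x) + (n + 1) • (d ^ n) x :=
      LinearMap.congr_fun (pow_succ_mul_of_mul_eq h n) x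
    rw [hn, pow_succ, mul_apply, hx, map_zero, map_zero, zero_add,
      ← Nat.cast_smul_eq_nsmul K] at key
    exact ih ((smul_eq_zero.mp key.symm).resolve_left (Nat.cast_ne_zero.mpr n.succ_ne_zero))

theorem le_inf_ker_sup_map (h : d * t = t * d + 1) (hd : ∀ x, ∃ n : ℕ, (d ^ n) x = 0)
    {N : Submodule K M} (hdN : N ∈ d.invtSubmodule) (htN : N ∈ t.invtSubmodule) :
    N ≤ N ⊓ LinearMap.ker d ⊔ N.map t := by
  intro x hx
  obtain ⟨n, hn⟩ := hd x
  induction n generalizing x with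
  | zero =>
    obtain rfl : x = 0 := by simpa using hn
    exact zero_mem _
  | succ n ih =>
    rcases n with _ | n
    · exact Submodule.mem_sup_left ⟨hx, by simpa using hn⟩
    -- On `ker d ^ (n + 2)`, `t d` is multiplication by `n + 1` modulo `ker d ^ (n + 1)`.
    set c : K := ((n + 1 : ℕ) : K)⁻¹
    have hty : t (c • d x) ∈ N.map t := Submodule.mem_map_of_mem (N.smul_mem c (hdN hx))
    have hpow : (d ^ (n + 1)) (x - t (c • d x)) = 0 := by
      have hshift : ∀ k, (d ^ k) (d x) = (d ^ (k + 1)) x := fun k => by rw [pow_succ, mul_apply]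
      have key : (d ^ (n + 1)) (t (d x)) = t ((d ^ (n + 1)) (d x)) + (n + 1) • (d ^ n) (d x) :=
        LinearMap.congr_fun (pow_succ_mul_of_mul_eq h n) (d x)
      rw [hshift, hshift, hn, map_zero, zero_add, ← Nat.cast_smul_eq_nsmul K] at key
      rw [map_sub, map_smul, map_smul, key, smul_smul,
        inv_mul_cancel₀ (Nat.cast_ne_zero.mpr n.succ_ne_zero), one_smul, sub_self]
    have := ih (N.sub_mem hx (htN (N.smul_mem c (hdN hx)))) hpow
    simpa using add_mem this (Submodule.mem_sup_right hty)

end Weyl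

section IsNilpotentWeyl

open Module.End

/-- A representation of the Weyl algebra by operators `t i` (the coordinates) and `d i` (the
partial derivatives), on which each `d i` is locally nilpotent. -/
structure IsNilpotentWeyl {R M ι : Type*} [Ring R] [AddCommGroup M] [Module R M]
    (d t : ι → Module.End R M) : Prop where
  d_mul_t : ∀ i, d i * t i = t i * d i + 1
  commute_d_t : ∀ i j, i ≠ j → Commute (d i) (t j)
  commute_d : ∀ i j, Commute (d i) (d j)
  commute_t : ∀ i j, Commute (t i) (t j)
  nilpotent : ∀ i x, ∃ n : ℕ, (d i ^ n) x = 0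

namespace IsNilpotentWeyl

variable {R M ι : Type*} [Ring R] [AddCommGroup M] [Module R M] {d t : ι → Module.End R M}

theorem eq_bot_of_disjoint [Finite ι] (h : IsNilpotentWeyl d t) {N : Submodule R M}
    (hN : ∀ i, N ∈ (d i).invtSubmodule) (hdisj : Disjoint N (⨅ i, LinearMap.ker (d i))) :
    N = ⊥ := by
  have := Fintype.ofFinite ι
  rw [← Finset.inf_univ_eq_iInf] at hdisj
  exact eq_bot_of_disjoint_finsetInf_ker h.commute_d h.nilpotent _ hN hdisj

theorem injective_of_intertwining [Finite ι] (h : IsNilpotentWeyl d t) {M' : Type*}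
    [AddCommGroup M'] [Module R M'] {d' : ι → Module.End R M'} {f : M →ₗ[R] M'}
    (hf : ∀ i x, f (d i x) = d' i (f x))
    (hdisj : Disjoint (LinearMap.ker f) (⨅ i, LinearMap.ker (d i))) : Function.Injective f := by
  refine LinearMap.ker_eq_bot.mp (h.eq_bot_of_disjoint (fun i x hx => ?_) hdisj)
  rw [Submodule.mem_comap, LinearMap.mem_ker, hf, LinearMap.mem_ker.mp hx, map_zero]

variable {K M : Type*} [DivisionRing K] [CharZero K] [AddCommGroup M] [Module K M]
  {d t : ι → Module.End K M}

theorem isCompl_finset (h : IsNilpotentWeyl d t) (s : Finset ι) :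
    IsCompl (s.inf fun i => LinearMap.ker (d i)) (s.sup fun i => LinearMap.range (t i)) := by
  induction s using Finset.cons_induction with
  | empty => simpa using isCompl_top_bot
  | cons j s hj ih =>
    have hne : ∀ i ∈ s, j ≠ i := fun i hi => (ne_of_mem_of_not_mem hi hj).symm
    rw [Finset.inf_cons, Finset.sup_cons]
    set k := s.inf fun i => LinearMap.ker (d i)
    set r := s.sup fun i => LinearMap.range (t i)
    have hk : k ≤ k ⊓ LinearMap.ker (d j) ⊔ k.map (t j) :=
      le_inf_ker_sup_map (h.d_mul_t j) (h.nilpotent j)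
        (finsetInf_ker_mem_invtSubmodule fun i _ => h.commute_d j i)
        (finsetInf_ker_mem_invtSubmodule fun i hi => (h.commute_d_t i j (hne i hi).symm).symm)
    have hr : r ≤ r ⊓ LinearMap.ker (d j) ⊔ r.map (t j) :=
      le_inf_ker_sup_map (h.d_mul_t j) (h.nilpotent j)
        (finsetSup_range_mem_invtSubmodule fun i hi => h.commute_d_t j i (hne i hi))
        (finsetSup_range_mem_invtSubmodule fun i _ => h.commute_t j i)
    constructor
    · have hle : LinearMap.range (t j) ⊔ r ≤
          r ⊓ LinearMap.ker (d j) ⊔ LinearMap.range (t j) :=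
        sup_le le_sup_right (hr.trans (sup_le_sup_left LinearMap.map_le_range _))
      have hker : (LinearMap.range (t j) ⊔ r) ⊓ LinearMap.ker (d j) ≤ r := by
        refine (inf_le_inf_right _ hle).trans ?_
        rw [sup_inf_assoc_of_le _ inf_le_right,
          (disjoint_ker_range (h.d_mul_t j) (h.nilpotent j)).symm.eq_bot, sup_bot_eq]
        exact inf_le_left
      rw [disjoint_comm, ← disjoint_assoc]
      exact ih.disjoint.symm.mono_left hker
    · rw [codisjoint_iff_le_sup, ← ih.sup_eq_top]
      refine sup_le (hk.trans ?_) (le_sup_right.trans le_sup_right)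
      rw [inf_comm]
      exact sup_le_sup_left (LinearMap.map_le_range.trans le_sup_left) _

theorem isCompl [Finite ι] (h : IsNilpotentWeyl d t) :
    IsCompl (⨅ i, LinearMap.ker (d i)) (⨆ i, LinearMap.range (t i)) := by
  have := Fintype.ofFinite ι
  rw [← Finset.inf_univ_eq_iInf, ← Finset.sup_univ_eq_iSup]
  exact h.isCompl_finset _

theorem eq_bot_of_le_iSup_range [Finite ι] (h : IsNilpotentWeyl d t) {N : Submodule K M}
    (hN : ∀ i, N ∈ (d i).invtSubmodule) (hle : N ≤ ⨆ i, LinearMap.range (t i)) : N = ⊥ :=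
  h.eq_bot_of_disjoint hN (h.isCompl.disjoint.symm.mono_left hle)

end IsNilpotentWeyl

end IsNilpotentWeyl

section MvPolynomial

open MvPolynomial

variable {σ R : Type*} [CommSemiring R]

theorem homogeneousComponent_pderiv (k : ℕ) (i : σ) (p : MvPolynomial σ R) :
    homogeneousComponent k (pderiv i p) = pderiv i (homogeneousComponent (k + 1) p) := by
  ext m
  simp [coeff_homogeneousComponent, coeff_pderiv, map_add]

theorem homogeneousComponent_one_eq_sum [Fintype σ] (p : MvPolynomial σ R) :
    homogeneousComponent 1 p = ∑ j, constantCoeff (pderiv j p) • X j := by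
  have euler := (homogeneousComponent_isHomogeneous 1 p).sum_X_mul_pderiv
  rw [one_smul] at euler
  rw [← euler]
  refine Finset.sum_congr rfl fun j _ => ?_
  rw [← homogeneousComponent_pderiv, homogeneousComponent_zero, ← constantCoeff_eq, smul_eq_C_mul,
    mul_comm]

theorem sum_homogeneousComponent_of_totalDegree_lt {p : MvPolynomial σ R} {n : ℕ}
    (h : p.totalDegree < n) : ∑ k ∈ Finset.range n, homogeneousComponent k p = p := by
  conv_rhs => rw [← sum_homogeneousComponent p]
  refine (Finset.sum_subset (Finset.range_subset_range.mpr h) fun k _ hk => ?_).symm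
  exact homogeneousComponent_eq_zero _ _ (by simpa using hk)

theorem exists_pderiv_pow_eq_zero (i : σ) (p : MvPolynomial σ R) :
    ∃ n : ℕ, ((pderiv i).toLinearMap ^ n) p = 0 := by
  suffices key : ∀ (n : ℕ) (p : MvPolynomial σ R), (∀ m, n ≤ m i → coeff m p = 0) →
      ((pderiv i).toLinearMap ^ n) p = 0 from
    ⟨p.degreeOf i + 1, key _ p fun m hm => notMem_support_iff.mp fun hmem =>
      (Nat.lt_succ_of_le (monomial_le_degreeOf i hmem)).not_ge hm⟩
  intro n
  induction n with
  | zero => exact fun p hp => MvPolynomial.ext _ _ fun m => hp m (Nat.zero_le _)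
  | succ n ih =>
    intro p hp
    rw [pow_succ, Module.End.mul_apply]
    refine ih _ fun m hm => ?_
    change coeff m (pderiv i p) = 0
    rw [coeff_pderiv, hp _ (by simpa using hm), zero_mul]

theorem mem_idealOfVars_iff {p : MvPolynomial σ R} :
    p ∈ idealOfVars σ R ↔ constantCoeff p = 0 := by
  rw [← pow_one (idealOfVars σ R), mem_pow_idealOfVars_iff']
  simp [constantCoeff_eq, Finsupp.degree_eq_zero_iff]

end MvPolynomial

section VectorFields

open MvPolynomial

theorem coe_partialS (i : Fin 2) : (partialS i : W₂) = pderiv i := rfl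

theorem SBar_ext {D E : SBar} (h : ∀ i, (D : W₂) (X i) = (E : W₂) (X i)) : D = E :=
  Subtype.ext (MvPolynomial.derivation_ext h)

/-- The subalgebra of the vector fields in `S̄₂` which vanish at the origin. -/
def vanishing : LieSubalgebra ℂ SBar where
  carrier := {D | ∀ f, constantCoeff ((D : W₂) f) = 0}
  add_mem' {D E} hD hE f := by simp [hD f, hE f]
  zero_mem' f := by simp
  smul_mem' c D hD f := by simp [hD f]
  lie_mem' {D E} hD hE f := by
    rw [LieSubalgebra.coe_bracket, Derivation.commutator_apply, map_sub, hD, hE, sub_zero]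

theorem mem_vanishing_iff {D : SBar} :
    D ∈ vanishing ↔ ∀ i, constantCoeff ((D : W₂) (X i)) = 0 := by
  refine ⟨fun h i => h (X i), fun h f => ?_⟩
  rw [apply_eq_sum, map_sum]
  exact Finset.sum_eq_zero fun k _ => by rw [map_mul, h, zero_mul]

theorem sub_sum_partialS_mem_vanishing (D : SBar) :
    D - ∑ i, constantCoeff ((D : W₂) (X i)) • partialS i ∈ vanishing := by
  refine mem_vanishing_iff.mpr fun i => ?_
  fin_cases i <;> simp [Fin.sum_univ_two, coe_partialS, pderiv_X, smul_eq_C_mul]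

/-- The Jacobian matrix at the origin of a vector field. -/
def linearPart : SBar →ₗ[ℂ] gl₂ where
  toFun D := (jacobian (D : W₂)).map constantCoeff
  map_add' D E := by ext; simp
  map_smul' c D := by ext; simp

theorem linearPart_apply (D : SBar) (j i : Fin 2) :
    linearPart D j i = constantCoeff (pderiv j ((D : W₂) (X i))) := rfl

theorem jacobian_partialS (i : Fin 2) : jacobian (partialS i : W₂) = 0 := by
  ext j k : 2
  simp [jacobian, coe_partialS, pderiv_X, Pi.single_apply, apply_ite]

theorem linearPart_partialS (i : Fin 2) : linearPart (partialS i) = 0 := by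
  ext j k
  simp [linearPart, jacobian_partialS]

/-- On the vector fields vanishing at the origin, the linear part is a homomorphism to `gl₂`. -/
def linearPartHom : vanishing →ₗ⁅ℂ⁆ gl₂ :=
  { linearPart ∘ₗ vanishing.toSubmodule.subtype with
    map_lie' := by
      intro D E
      ext j i
      simp [linearPart, jacobian_lie, LieRing.of_associative_ring_bracket, Matrix.mul_apply,
        D.2 _, E.2 _] }

/-- The ideal of the vector fields in `S̄₂` with vanishing constant and linear terms. -/
def higher : LieIdeal ℂ vanishing := linearPartHom.ker

theorem mem_higher_iff {D : vanishing} : D ∈ higher ↔ linearPart (D : SBar) = 0 := Iff.rfl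

/-- The embedding of `gl₂` as the linear vector fields, `E_{ji} ↦ tⱼ ∂ᵢ`. -/
def linearFieldHom : gl₂ →ₗ⁅ℂ⁆ vanishing where
  toFun G := ⟨⟨mkDerivation ℂ fun i => ∑ j, G j i • (X j : A₂), ∑ i, G i i, by
    simp [divergence, pderiv_X, Fin.sum_univ_two, smul_eq_C_mul]⟩,
    mem_vanishing_iff.mpr fun i => by simp⟩
  map_add' G H := by
    refine Subtype.ext (SBar_ext fun i => ?_)
    simp [add_smul, Finset.sum_add_distrib]
  map_smul' c G := by
    refine Subtype.ext (SBar_ext fun i => ?_)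
    simp [mul_smul]
  map_lie' {G H} := by
    refine Subtype.ext (SBar_ext fun i => ?_)
    simp [Derivation.commutator_apply, LieRing.of_associative_ring_bracket, Fin.sum_univ_two,
      Matrix.mul_apply]
    module

theorem linearFieldHom_X (G : gl₂) (i : Fin 2) :
    ((linearFieldHom G : SBar) : W₂) (X i) = ∑ j, G j i • (X j : A₂) :=
  mkDerivation_X ..

theorem linearPart_linearFieldHom (G : gl₂) : linearPart (linearFieldHom G) = G := by
  ext j i
  fin_cases j <;> simp [linearPart_apply, linearFieldHom_X, pderiv_X]

theorem linearFieldHom_one_apply {p : A₂} {n : ℕ} (hp : p.IsHomogeneous n) :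
    ((linearFieldHom 1 : SBar) : W₂) p = (n : ℂ) • p := by
  rw [apply_eq_sum, Nat.cast_smul_eq_nsmul, ← hp.sum_X_mul_pderiv]
  simp [linearFieldHom_X, Matrix.one_apply]

theorem divergence_mkDerivation_homogeneousComponent (k : ℕ) (D : W₂) :
    divergence (mkDerivation ℂ fun i => homogeneousComponent (k + 1) (D (X i)))
      = homogeneousComponent k (divergence D) := by
  simp [divergence, homogeneousComponent_pderiv]

/-- The part of a vector field which has degree `k` for the grading with `∂ᵢ` in degree `-1`, so
that its coefficients are homogeneous of degree `k + 1`. -/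
def homogeneousPart (k : ℕ) (D : SBar) : vanishing :=
  ⟨⟨mkDerivation ℂ fun i => homogeneousComponent (k + 1) ((D : W₂) (X i)), by
      obtain ⟨c, hc⟩ := D.2
      refine ⟨if 0 = k then c else 0, ?_⟩
      rw [divergence_mkDerivation_homogeneousComponent, hc,
        homogeneousComponent_of_mem (isHomogeneous_C _ c)]
      split_ifs <;> simp_all⟩,
    mem_vanishing_iff.mpr fun i => by simp [constantCoeff_eq, coeff_homogeneousComponent]⟩

theorem homogeneousPart_X (k : ℕ) (D : SBar) (i : Fin 2) :
    ((homogeneousPart k D : SBar) : W₂) (X i) = homogeneousComponent (k + 1) ((D : W₂) (X i)) :=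
  mkDerivation_X ..

theorem linearFieldHom_one_lie_homogeneousPart (k : ℕ) (D : SBar) :
    ⁅linearFieldHom 1, homogeneousPart k D⁆ = (k : ℂ) • homogeneousPart k D := by
  refine Subtype.ext (SBar_ext fun i => ?_)
  change ((linearFieldHom 1 : SBar) : W₂) (((homogeneousPart k D : SBar) : W₂) (X i))
    - ((homogeneousPart k D : SBar) : W₂) (((linearFieldHom 1 : SBar) : W₂) (X i))
    = (k : ℂ) • ((homogeneousPart k D : SBar) : W₂) (X i)
  rw [linearFieldHom_one_apply (isHomogeneous_X ℂ i), homogeneousPart_X,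
    linearFieldHom_one_apply (homogeneousComponent_isHomogeneous _ _), Derivation.map_smul,
    homogeneousPart_X]
  push_cast
  module

theorem homogeneousPart_zero (D : SBar) : homogeneousPart 0 D = linearFieldHom (linearPart D) := by
  refine Subtype.ext (SBar_ext fun i => ?_)
  rw [homogeneousPart_X, zero_add, homogeneousComponent_one_eq_sum, linearFieldHom_X]
  rfl

theorem exists_eq_sum_homogeneousPart (D : vanishing) :
    ∃ n, D = ∑ k ∈ Finset.range n, homogeneousPart k D := by
  obtain ⟨n, hn⟩ : ∃ n, ∀ i, (((D : SBar) : W₂) (X i)).totalDegree < n + 1 :=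
    ⟨Finset.univ.sup fun i => (((D : SBar) : W₂) (X i)).totalDegree, fun i =>
      Nat.lt_succ_of_le (Finset.le_sup (f := fun i => (((D : SBar) : W₂) (X i)).totalDegree)
        (Finset.mem_univ i))⟩
  refine ⟨n, Subtype.ext (SBar_ext fun i => ?_)⟩
  have hsum := sum_homogeneousComponent_of_totalDegree_lt (hn i)
  rw [Finset.sum_range_succ', homogeneousComponent_zero, ← constantCoeff_eq, D.2, C_0,
    add_zero] at hsum
  simp only [AddSubmonoidClass.coe_finsetSum, ← Derivation.coeFnAddMonoidHom_apply, map_sum,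
    Finset.sum_apply]
  simp only [Derivation.coeFnAddMonoidHom_apply, homogeneousPart_X, hsum]

end VectorFields

section EulerField

theorem lie_mem_eigenspace {R L Q : Type*} [CommRing R] [LieRing L] [LieAlgebra R L]
    [AddCommGroup Q] [Module R Q] [LieRingModule L Q] [LieModule R L Q] {e x : L} {q : Q} {c l : R}
    (hx : ⁅e, x⁆ = c • x) (hq : q ∈ (LieModule.toEnd R L Q e).eigenspace l) :
    ⁅x, q⁆ ∈ (LieModule.toEnd R L Q e).eigenspace (l + c) := by
  rw [Module.End.mem_eigenspace_iff, LieModule.toEnd_apply_apply] at *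
  rw [leibniz_lie, hx, hq, smul_lie, lie_smul]
  module

theorem exists_ne_zero_forall_lie_eq_zero {L Q : Type*} [LieRing L] [LieAlgebra ℂ L]
    [AddCommGroup Q] [Module ℂ Q] [LieRingModule L Q] [LieModule ℂ L Q] [FiniteDimensional ℂ Q]
    [Nontrivial Q] (e : L) :
    ∃ q : Q, q ≠ 0 ∧ ∀ (x : L) (c : ℂ), 0 < c.re → ⁅e, x⁆ = c • x → ⁅x, q⁆ = 0 := by
  set E := LieModule.toEnd ℂ L Q e
  obtain ⟨l, hl, hmax⟩ := Set.exists_max_image {l : ℂ | E.HasEigenvalue l} Complex.re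
    E.finite_hasEigenvalue E.exists_eigenvalue
  obtain ⟨q, hq⟩ := Module.End.HasEigenvalue.exists_hasEigenvector hl
  refine ⟨q, hq.2, fun x c hc hx => ?_⟩
  by_contra h0
  have hle := hmax _ (Module.End.hasEigenvalue_of_hasEigenvector
    ⟨lie_mem_eigenspace hx hq.1, h0⟩)
  rw [Complex.add_re] at hle
  linarith

theorem exists_ne_zero_forall_higher_lie_eq_zero (Q : Type*) [AddCommGroup Q] [Module ℂ Q]
    [LieRingModule vanishing Q] [LieModule ℂ vanishing Q] [FiniteDimensional ℂ Q] [Nontrivial Q] :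
    ∃ q : Q, q ≠ 0 ∧ ∀ x ∈ higher, ⁅x, q⁆ = 0 := by
  obtain ⟨q, hq0, hq⟩ := exists_ne_zero_forall_lie_eq_zero (Q := Q) (linearFieldHom 1)
  refine ⟨q, hq0, fun x hx => ?_⟩
  obtain ⟨n, hn⟩ := exists_eq_sum_homogeneousPart x
  rw [hn, sum_lie]
  refine Finset.sum_eq_zero fun k _ => ?_
  obtain rfl | hk := k.eq_zero_or_pos
  · rw [homogeneousPart_zero, mem_higher_iff.mp hx, map_zero, zero_lie]
  · exact hq _ k (by simpa using hk) (linearFieldHom_one_lie_homogeneousPart k x)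

end EulerField

section Modules

open MvPolynomial

variable (M : Type u) [AddCommGroup M] [Module ℂ M] [LieRingModule STilde M] [LieModule ℂ STilde M]

instance : LieRingModule SBar M := LieRingModule.compLieHom M ofS

instance : LieModule ℂ SBar M := LieModule.compLieHom M ofS

/-- The action of polynomials on an `S̃₂`-module. -/
def polyAct : A₂ →ₗ[ℂ] Module.End ℂ M :=
  (LieModule.toEnd ℂ STilde M : STilde →ₗ[ℂ] Module.End ℂ M) ∘ₗ (ofA : A₂ →ₗ[ℂ] STilde)

/-- The operator `∂ᵢ - aᵢ` on an `S̃₂`-module. -/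
def shiftedPartial (a : Fin 2 → ℂ) (i : Fin 2) : Module.End ℂ M :=
  LieModule.toEnd ℂ SBar M (partialS i) - a i • 1

variable {M}

theorem ofS_lie_ofA (D : SBar) (f : A₂) : ⁅ofS D, ofA f⁆ = ofA ((D : W₂) f) := by
  refine LieAlgebra.SemiDirectSum.ext ?_ ?_
  · simp only [LieAlgebra.SemiDirectSum.lie_eq_mk, LieAlgebra.SemiDirectSum.inl_eq_mk,
      LieAlgebra.SemiDirectSum.inr_eq_mk, zero_lie, zero_add, map_zero, sub_zero]
    rfl
  · simp only [LieAlgebra.SemiDirectSum.lie_eq_mk, LieAlgebra.SemiDirectSum.inl_eq_mk,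
      LieAlgebra.SemiDirectSum.inr_eq_mk, lie_zero]

theorem lie_polyAct (D : SBar) (f : A₂) (v : M) :
    ⁅D, polyAct M f v⁆ = polyAct M ((D : W₂) f) v + polyAct M f ⁅D, v⁆ := by
  change ⁅ofS D, ⁅ofA f, v⁆⁆ = ⁅ofA ((D : W₂) f), v⁆ + ⁅ofA f, ⁅ofS D, v⁆⁆
  rw [leibniz_lie, ofS_lie_ofA]

theorem STilde_lie_eq (x : STilde) (v : M) : ⁅x, v⁆ = polyAct M x.left v + ⁅x.right, v⁆ := by
  have h : x = ofA x.left + ofS x.right :=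
    LieAlgebra.SemiDirectSum.ext (add_zero _).symm (zero_add _).symm
  conv_lhs => rw [h]
  exact add_lie _ _ _

theorem IsASModule.polyAct_mul (hM : IsASModule M) (f g : A₂) (v : M) :
    polyAct M (f * g) v = polyAct M f (polyAct M g v) :=
  (hM.mul_act f g v).symm

theorem IsASModule.polyAct_one (hM : IsASModule M) (v : M) : polyAct M 1 v = v :=
  hM.one_act v

theorem IsASModule.polyAct_C (hM : IsASModule M) (c : ℂ) (v : M) : polyAct M (C c) v = c • v := by
  rw [← mul_one (C c), ← smul_eq_C_mul, map_smul, LinearMap.smul_apply, hM.polyAct_one]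

variable {a : Fin 2 → ℂ}

theorem shiftedPartial_apply (i : Fin 2) (v : M) :
    shiftedPartial M a i v = ⁅partialS i, v⁆ - a i • v := rfl

theorem shiftedPartial_lie (i : Fin 2) (D : SBar) (v : M) :
    shiftedPartial M a i ⁅D, v⁆ = ⁅⁅partialS i, D⁆, v⁆ + ⁅D, shiftedPartial M a i v⁆ := by
  rw [shiftedPartial_apply, shiftedPartial_apply, leibniz_lie, lie_sub, lie_smul]
  abel

theorem shiftedPartial_polyAct (i : Fin 2) (f : A₂) (v : M) :
    shiftedPartial M a i (polyAct M f v)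
      = polyAct M (pderiv i f) v + polyAct M f (shiftedPartial M a i v) := by
  rw [shiftedPartial_apply, shiftedPartial_apply, lie_polyAct, map_sub, map_smul, coe_partialS]
  abel

theorem commute_shiftedPartial (i j : Fin 2) :
    Commute (shiftedPartial M a i) (shiftedPartial M a j) := by
  refine LinearMap.ext fun v => ?_
  rw [Module.End.mul_apply, Module.End.mul_apply, shiftedPartial_apply j, map_sub, map_smul,
    shiftedPartial_lie, partialS_lie, zero_lie, zero_add, shiftedPartial_apply j]

theorem IsASModule.commute_polyAct (hM : IsASModule M) (f g : A₂) :
    Commute (polyAct M f) (polyAct M g) := by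
  refine LinearMap.ext fun v => ?_
  rw [Module.End.mul_apply, Module.End.mul_apply, ← hM.polyAct_mul, ← hM.polyAct_mul, mul_comm]

theorem IsASModule.isNilpotentWeyl (hM : IsASModule M)
    (hnil : ∀ i (v : M), ∃ n : ℕ, (shiftedPartial M a i ^ n) v = 0) :
    IsNilpotentWeyl (shiftedPartial M a) (fun i => polyAct M (X i)) where
  d_mul_t i := by
    refine LinearMap.ext fun v => ?_
    rw [Module.End.mul_apply, shiftedPartial_polyAct, pderiv_X_self, hM.polyAct_one, add_comm]
    rfl
  commute_d_t i j hij := by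
    refine LinearMap.ext fun v => ?_
    rw [Module.End.mul_apply, shiftedPartial_polyAct, pderiv_X_of_ne hij.symm, map_zero,
      LinearMap.zero_apply, zero_add, Module.End.mul_apply]
  commute_d := commute_shiftedPartial
  commute_t i j := hM.commute_polyAct (X i) (X j)
  nilpotent := hnil

theorem IsOfType.exists_shiftedPartial_pow_eq_zero (ht : IsOfType M a) (i : Fin 2) (v : M) :
    ∃ n : ℕ, (shiftedPartial M a i ^ n) v = 0 := by
  obtain ⟨n, hn⟩ := ht v ⟨partialS i, partialS_mem i⟩
  rw [phi_partialS] at hn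
  exact ⟨n, hn⟩

theorem lie_partialS_of_mem_Wh {v : M} (hv : v ∈ Wh M a) (i : Fin 2) :
    ⁅partialS i, v⁆ = a i • v := by
  rw [← phi_partialS a i]
  exact hv ⟨partialS i, partialS_mem i⟩

theorem Wh_eq_iInf_ker : Wh M a = ⨅ i, LinearMap.ker (shiftedPartial M a i) := by
  ext v
  simp only [Submodule.mem_iInf, LinearMap.mem_ker, shiftedPartial_apply, sub_eq_zero]
  refine ⟨lie_partialS_of_mem_Wh, fun h ⟨x, hx⟩ => ?_⟩
  obtain ⟨c, rfl⟩ := (Submodule.mem_span_range_iff_exists_fun ℂ).mp hx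
  have hsum : (⟨∑ i, c i • partialS i, hx⟩ : Delta)
      = ∑ i, c i • (⟨partialS i, partialS_mem i⟩ : Delta) :=
    Subtype.ext (by simp [Fin.sum_univ_two])
  change ⁅∑ i, c i • partialS i, v⁆ = _
  rw [hsum, map_sum, Finset.sum_smul, sum_lie]
  refine Finset.sum_congr rfl fun i _ => ?_
  rw [map_smul, phi_partialS, smul_lie, h, smul_smul, smul_eq_mul]

theorem shiftedPartial_of_mem_Wh {v : M} (hv : v ∈ Wh M a) (i : Fin 2) :
    shiftedPartial M a i v = 0 :=
  sub_eq_zero.mpr (lie_partialS_of_mem_Wh hv i)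

end Modules

section Fiber

open MvPolynomial

variable {M : Type u} [AddCommGroup M] [Module ℂ M] [LieRingModule STilde M] [LieModule ℂ STilde M]

variable (M) in
/-- The subspace `𝔪 M`, where `𝔪` is the maximal ideal of the origin. -/
def originSubspace : Submodule ℂ M :=
  Submodule.map₂ (polyAct M) ((idealOfVars (Fin 2) ℂ).restrictScalars ℂ) ⊤

theorem polyAct_mem_originSubspace {f : A₂} (hf : constantCoeff f = 0) (v : M) :
    polyAct M f v ∈ originSubspace M :=
  Submodule.apply_mem_map₂ _ (mem_idealOfVars_iff.mpr hf) trivial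

theorem originSubspace_le {N : Submodule ℂ M}
    (h : ∀ f, constantCoeff f = 0 → ∀ v, polyAct M f v ∈ N) : originSubspace M ≤ N :=
  Submodule.map₂_le.mpr fun f hf v _ => h f (mem_idealOfVars_iff.mp hf) v

theorem lie_mem_originSubspace {D : SBar} (hD : D ∈ vanishing) {w : M}
    (hw : w ∈ originSubspace M) : ⁅D, w⁆ ∈ originSubspace M := by
  suffices h : originSubspace M ≤ (originSubspace M).comap (LieModule.toEnd ℂ SBar M D) from h hw
  refine originSubspace_le fun f hf v => ?_
  rw [Submodule.mem_comap, LieModule.toEnd_apply_apply, lie_polyAct]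
  exact add_mem (polyAct_mem_originSubspace (hD f) v) (polyAct_mem_originSubspace hf _)

variable (M) in
/-- The subspace `𝔪 M` as a submodule over the vector fields vanishing at the origin. -/
def originSubmodule : LieSubmodule ℂ vanishing M where
  toSubmodule := originSubspace M
  lie_mem {D _} hw := lie_mem_originSubspace D.2 hw

theorem IsASModule.originSubspace_eq_iSup_range (hM : IsASModule M) :
    originSubspace M = ⨆ i, LinearMap.range (polyAct M (X i)) := by
  apply le_antisymm
  · refine Submodule.map₂_le.mpr fun f hf v _ => ?_
    rw [Submodule.restrictScalars_mem] at hf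
    induction hf using Submodule.span_induction generalizing v with
    | mem f hf =>
      obtain ⟨i, rfl⟩ := hf
      exact Submodule.mem_iSup_of_mem i ⟨v, rfl⟩
    | zero => simp
    | add f g _ _ hf hg =>
      rw [map_add]
      exact add_mem (hf v trivial) (hg v trivial)
    | smul g f _ hf =>
      rw [smul_eq_mul, mul_comm, hM.polyAct_mul]
      exact hf _ trivial
  · refine iSup_le fun i => ?_
    rintro _ ⟨v, rfl⟩
    exact polyAct_mem_originSubspace (constantCoeff_X ℂ i) v

variable {a : Fin 2 → ℂ}

theorem IsASModule.isCompl_Wh_originSubspace (hM : IsASModule M)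
    (hnil : ∀ i (v : M), ∃ n : ℕ, (shiftedPartial M a i ^ n) v = 0) :
    IsCompl (Wh M a) (originSubspace M) := by
  rw [Wh_eq_iInf_ker, hM.originSubspace_eq_iSup_range]
  exact (hM.isNilpotentWeyl hnil).isCompl

variable (M) in
/-- The fibre `M / 𝔪 M` of `M` at the origin. -/
abbrev OriginFiber : Type u := M ⧸ originSubmodule M

variable (M) in
/-- The projection of `M` to its fibre at the origin. -/
abbrev toFiber : M →ₗ⁅ℂ,vanishing⁆ OriginFiber M := LieSubmodule.Quotient.mk' (originSubmodule M)

instance : LieRingModule gl₂ (OriginFiber M) :=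
  LieRingModule.compLieHom (OriginFiber M) linearFieldHom

instance : LieModule ℂ gl₂ (OriginFiber M) := LieModule.compLieHom (OriginFiber M) linearFieldHom

theorem lie_fiber_eq (G : gl₂) (q : OriginFiber M) : ⁅G, q⁆ = ⁅linearFieldHom G, q⁆ := rfl

theorem IsASModule.toFiber_polyAct (hM : IsASModule M) (f : A₂) (v : M) :
    toFiber M (polyAct M f v) = constantCoeff f • toFiber M v := by
  rw [← map_smul, ← sub_eq_zero, ← map_sub, ← hM.polyAct_C, ← LinearMap.sub_apply, ← map_sub,
    LieSubmodule.Quotient.mk_eq_zero]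
  exact polyAct_mem_originSubspace (by simp) v

/-- A vector of the fibre at the origin has exactly one representative which is a Whittaker
vector. -/
def IsASModule.fiberEquivWh (hM : IsASModule M) (ht : IsOfType M a) :
    OriginFiber M ≃ₗ[ℂ] Wh M a :=
  Submodule.quotientEquivOfIsCompl _ _
    (hM.isCompl_Wh_originSubspace ht.exists_shiftedPartial_pow_eq_zero).symm

theorem IsASModule.toFiber_fiberEquivWh (hM : IsASModule M) (ht : IsOfType M a)
    (q : OriginFiber M) : toFiber M (hM.fiberEquivWh ht q) = q :=
  Submodule.mk_quotientEquivOfIsCompl_apply _ q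

theorem IsASModule.nontrivial_fiber (hM : IsASModule M) (ht : IsOfType M a) [Nontrivial M] :
    Nontrivial (OriginFiber M) := by
  have hWeyl := hM.isNilpotentWeyl ht.exists_shiftedPartial_pow_eq_zero
  have hWh : Wh M a ≠ ⊥ := fun h => top_ne_bot <| hWeyl.eq_bot_of_disjoint
    (fun i => Module.End.invtSubmodule.top_mem _)
    (by rw [← Wh_eq_iInf_ker, h]; exact disjoint_bot_right)
  have := Submodule.nontrivial_iff_ne_bot.mpr hWh
  exact (hM.fiberEquivWh ht).toEquiv.nontrivial

variable (M) in
/-- The vectors of the fibre at the origin which are killed by the fields without constant and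
linear terms. -/
def higherInvariants : LieSubmodule ℂ gl₂ (OriginFiber M) where
  carrier := {q | ∀ x ∈ higher, ⁅x, q⁆ = 0}
  add_mem' {q r} hq hr x hx := by rw [lie_add, hq x hx, hr x hx, add_zero]
  zero_mem' x _ := lie_zero x
  smul_mem' c q hq x hx := by rw [lie_smul, hq x hx, smul_zero]
  lie_mem {G q} hq x hx := by
    rw [lie_fiber_eq, leibniz_lie, hq x hx, lie_zero, add_zero]
    exact hq _ (lie_mem_left ℂ vanishing higher x _ hx)

theorem higherInvariants_ne_bot [FiniteDimensional ℂ (OriginFiber M)]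
    [Nontrivial (OriginFiber M)] : higherInvariants M ≠ ⊥ := by
  obtain ⟨q, hq0, hq⟩ := exists_ne_zero_forall_higher_lie_eq_zero (OriginFiber M)
  have hmem : q ∈ higherInvariants M := hq
  exact fun h => hq0 ((LieSubmodule.mem_bot q).mp (h ▸ hmem))

theorem lie_eq_linearPart_lie {q : OriginFiber M} (hq : q ∈ higherInvariants M) (D : vanishing) :
    ⁅D, q⁆ = ⁅linearPart (D : SBar), q⁆ := by
  have hmem : D - linearFieldHom (linearPart (D : SBar)) ∈ higher := by
    rw [mem_higher_iff, AddSubgroupClass.coe_sub, map_sub, linearPart_linearFieldHom, sub_self]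
  rw [lie_fiber_eq, ← sub_eq_zero, ← sub_lie, hq _ hmem]

theorem toFiber_lie_of_mem_Wh {v : M} (hv : v ∈ Wh M a)
    (hq : toFiber M v ∈ higherInvariants M) (D : SBar) :
    toFiber M ⁅D, v⁆ = (∑ i, constantCoeff ((D : W₂) (X i)) * a i) • toFiber M v
      + ⁅linearPart D, toFiber M v⁆ := by
  set D₀ : SBar := D - ∑ i, constantCoeff ((D : W₂) (X i)) • partialS i with hD₀
  have hmem : D₀ ∈ vanishing := sub_sum_partialS_mem_vanishing D
  have hlin : linearPart D₀ = linearPart D := by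
    simp [hD₀, linearPart_partialS]
  have hfib : toFiber M ⁅D₀, v⁆ = ⁅linearPart D, toFiber M v⁆ := by
    rw [← hlin, ← lie_eq_linearPart_lie hq ⟨D₀, hmem⟩, ← LieModuleHom.map_lie]
    rfl
  have hD : D = ∑ i, constantCoeff ((D : W₂) (X i)) • partialS i + D₀ := by
    rw [hD₀, add_sub_cancel]
  conv_lhs => rw [hD]
  rw [add_lie, map_add, hfib, sum_lie, Finset.sum_smul, map_sum]
  simp only [smul_lie, lie_partialS_of_mem_Wh hv, map_smul, smul_smul]

end Fiber

section Tensor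

open MvPolynomial

variable (a : Fin 2 → ℂ) (V : Type u) [AddCommGroup V] [Module ℂ V]

/-- The pure tensors `p ⊗ v` in `T(A₂ᵃ, V)`. -/
def T.tmul : A₂ →ₗ[ℂ] V →ₗ[ℂ] T a V := TensorProduct.mk ℂ A₂ V

variable {a V}

theorem T.induction {motive : T a V → Prop} (zero : motive 0)
    (add : ∀ x y, motive x → motive y → motive (x + y))
    (tmul : ∀ p v, motive (T.tmul a V p v)) (w : T a V) : motive w :=
  TensorProduct.induction_on (motive := motive) w zero tmul add

variable [LieRingModule gl₂ V] [LieModule ℂ gl₂ V]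

theorem polyAct_tmul (f p : A₂) (v : V) :
    polyAct (T a V) f (T.tmul a V p v) = T.tmul a V (f * p) v := by
  change tensorAct V a (ofA f) (p ⊗ₜ v) = (f * p) ⊗ₜ v
  simp [tensorAct]

theorem lie_tmul (D : SBar) (p : A₂) (v : V) :
    ⁅D, T.tmul a V p v⁆ = T.tmul a V (twistedAct a (D : W₂) p) v
      + ∑ j, ∑ i, T.tmul a V (jacobian (D : W₂) j i * p) ⁅(Matrix.single j i 1 : gl₂), v⁆ := by
  have h : tensorAct V a (ofS D) (p ⊗ₜ v)
      = twistedAct a (D : W₂) p ⊗ₜ v + matAct V (jacobian (D : W₂)) (p ⊗ₜ v) := by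
    simp [tensorAct]
  rw [matAct_tmul] at h
  exact h

theorem isASModule_T : IsASModule (T a V) where
  mul_act f g w := by
    change polyAct (T a V) f (polyAct (T a V) g w) = polyAct (T a V) (f * g) w
    induction w using T.induction with
    | zero => simp only [map_zero]
    | add x y hx hy => simp only [map_add, hx, hy]
    | tmul p v => simp only [polyAct_tmul, mul_assoc]
  one_act w := by
    change polyAct (T a V) 1 w = w
    induction w using T.induction with
    | zero => exact map_zero _
    | add x y hx hy => rw [map_add, hx, hy]
    | tmul p v => rw [polyAct_tmul, one_mul]

theorem shiftedPartial_tmul (i : Fin 2) (p : A₂) (v : V) :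
    shiftedPartial (T a V) a i (T.tmul a V p v) = T.tmul a V (pderiv i p) v := by
  have htwist : twistedAct a (partialS i : W₂) p = pderiv i p + a i • p := by
    fin_cases i <;> simp [twistedAct, coe_partialS, Fin.sum_univ_two, pderiv_X]
  rw [shiftedPartial_apply, lie_tmul, jacobian_partialS, htwist]
  simp

theorem shiftedPartial_pow_tmul (i : Fin 2) (n : ℕ) (p : A₂) (v : V) :
    (shiftedPartial (T a V) a i ^ n) (T.tmul a V p v)
      = T.tmul a V (((pderiv i : W₂).toLinearMap ^ n) p) v := by
  induction n with
  | zero => rfl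
  | succ n ih =>
    rw [pow_succ', pow_succ', Module.End.mul_apply, Module.End.mul_apply, ih, shiftedPartial_tmul]
    rfl

theorem exists_shiftedPartial_T_pow_eq_zero (i : Fin 2) (w : T a V) :
    ∃ n : ℕ, (shiftedPartial (T a V) a i ^ n) w = 0 := by
  induction w using T.induction with
  | zero => exact ⟨0, map_zero _⟩
  | add x y hx hy =>
    obtain ⟨m, hm⟩ := hx
    obtain ⟨n, hn⟩ := hy
    refine ⟨max m n, ?_⟩
    rw [map_add, Module.End.pow_map_zero_of_le (le_max_left m n) hm,
      Module.End.pow_map_zero_of_le (le_max_right m n) hn, add_zero]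
  | tmul p v =>
    obtain ⟨n, hn⟩ := exists_pderiv_pow_eq_zero i p
    exact ⟨n, by rw [shiftedPartial_pow_tmul, hn, map_zero, LinearMap.zero_apply]⟩

theorem isNilpotentWeyl_T :
    IsNilpotentWeyl (shiftedPartial (T a V) a) (fun i => polyAct (T a V) (X i)) :=
  isASModule_T.isNilpotentWeyl exists_shiftedPartial_T_pow_eq_zero

theorem tmul_one_mem_Wh (v : V) : T.tmul a V 1 v ∈ Wh (T a V) a := by
  simp [Wh_eq_iInf_ker, shiftedPartial_tmul]

theorem range_tmul_one_sup_originSubspace :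
    LinearMap.range (T.tmul a V 1) ⊔ originSubspace (T a V) = ⊤ := by
  refine eq_top_iff.mpr fun w _ => ?_
  induction w using T.induction with
  | zero => exact zero_mem _
  | add x y hx hy => exact add_mem (hx trivial) (hy trivial)
  | tmul p v =>
    have hp : T.tmul a V p v = T.tmul a V 1 (constantCoeff p • v)
        + polyAct (T a V) (p - C (constantCoeff p)) (T.tmul a V 1 v) := by
      rw [polyAct_tmul, mul_one, map_sub, LinearMap.sub_apply, ← mul_one (C _), ← smul_eq_C_mul,
        map_smul, map_smul, LinearMap.smul_apply, add_sub_cancel]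
    rw [hp]
    exact Submodule.add_mem_sup ⟨_, rfl⟩ (polyAct_mem_originSubspace (by simp) _)

theorem Wh_T_eq_range : Wh (T a V) a = LinearMap.range (T.tmul a V 1) := by
  have hcompl := isASModule_T.isCompl_Wh_originSubspace (M := T a V)
    exists_shiftedPartial_T_pow_eq_zero
  refine (eq_of_le_of_inf_le_of_sup_le (z := originSubspace (T a V)) ?_ ?_ ?_).symm
  · rintro _ ⟨v, rfl⟩
    exact tmul_one_mem_Wh v
  · rw [hcompl.inf_eq_bot]
    exact bot_le
  · rw [range_tmul_one_sup_originSubspace]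
    exact le_top

end Tensor

section Comparison

open MvPolynomial

variable {M : Type u} [AddCommGroup M] [Module ℂ M] [LieRingModule STilde M] [LieModule ℂ STilde M]
  {a : Fin 2 → ℂ} {V : Type u} [AddCommGroup V] [Module ℂ V]

/-- The linear map `T(A₂ᵃ, V) → M`, `p ⊗ v ↦ p (s v)`, extending a family `s` of Whittaker
vectors. -/
def comparison (s : V →ₗ[ℂ] Wh M a) : T a V →ₗ[ℂ] M :=
  (TensorProduct.lift (LinearMap.lcomp ℂ M ((Wh M a).subtype ∘ₗ s) ∘ₗ polyAct M) :
    A₂ ⊗[ℂ] V →ₗ[ℂ] M)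

variable {s : V →ₗ[ℂ] Wh M a}

theorem comparison_tmul (p : A₂) (v : V) :
    comparison s (T.tmul a V p v) = polyAct M p (s v) :=
  TensorProduct.lift.tmul p v

theorem IsASModule.comparison_tmul_one (hM : IsASModule M) (v : V) :
    comparison s (T.tmul a V 1 v) = s v := by
  rw [comparison_tmul, hM.polyAct_one]

theorem IsASModule.toFiber_comparison_tmul (hM : IsASModule M) (p : A₂) (v : V) :
    toFiber M (comparison s (T.tmul a V p v)) = constantCoeff p • toFiber M (s v) := by
  rw [comparison_tmul, hM.toFiber_polyAct]

variable [LieRingModule gl₂ V] [LieModule ℂ gl₂ V]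

theorem comparison_shiftedPartial (i : Fin 2) (w : T a V) :
    comparison s (shiftedPartial (T a V) a i w) = shiftedPartial M a i (comparison s w) := by
  induction w using T.induction with
  | zero => simp only [map_zero]
  | add x y hx hy => simp only [map_add, hx, hy]
  | tmul p v =>
    rw [shiftedPartial_tmul, comparison_tmul, comparison_tmul, shiftedPartial_polyAct,
      shiftedPartial_of_mem_Wh (s v).2, map_zero, add_zero]

theorem IsASModule.comparison_polyAct (hM : IsASModule M) (f : A₂) (w : T a V) :
    comparison s (polyAct (T a V) f w) = polyAct M f (comparison s w) := by
  induction w using T.induction with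
  | zero => simp only [map_zero]
  | add x y hx hy => simp only [map_add, hx, hy]
  | tmul p v => rw [polyAct_tmul, comparison_tmul, comparison_tmul, hM.polyAct_mul]

theorem IsASModule.comparison_injective (hM : IsASModule M) (hs : Function.Injective s) :
    Function.Injective (comparison s) := by
  refine isNilpotentWeyl_T.injective_of_intertwining comparison_shiftedPartial ?_
  rw [← Wh_eq_iInf_ker, Wh_T_eq_range, Submodule.disjoint_def]
  rintro _ hker ⟨v, rfl⟩
  rw [LinearMap.mem_ker, hM.comparison_tmul_one, ZeroMemClass.coe_eq_zero] at hker
  rw [hs (hker.trans (map_zero s).symm), map_zero]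

variable {ι : V →ₗ⁅ℂ,gl₂⁆ higherInvariants M}

theorem IsASModule.toFiber_comparison_lie (hM : IsASModule M)
    (hι : ∀ v, toFiber M (s v) = ι v) (D : SBar) (v : V) :
    toFiber M (comparison s ⁅D, T.tmul a V 1 v⁆) = toFiber M ⁅D, (s v : M)⁆ := by
  have htwist : constantCoeff (twistedAct a (D : W₂) 1)
      = ∑ i, constantCoeff ((D : W₂) (X i)) * a i := by
    simp [twistedAct, Fin.sum_univ_two, mul_comm]
  have hlin : linearPart D = ∑ j, ∑ i,
      constantCoeff (jacobian (D : W₂) j i) • (Matrix.single j i 1 : gl₂) := by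
    conv_lhs => rw [Matrix.matrix_eq_sum_single (linearPart D)]
    simp [Matrix.smul_single, jacobian, linearPart]
  rw [toFiber_lie_of_mem_Wh (s v).2 (by rw [hι]; exact (ι v).2), hι, lie_tmul, hlin]
  simp only [map_add, map_sum, hM.toFiber_comparison_tmul, hι, htwist, mul_one, sum_lie, smul_lie,
    LieModuleHom.map_lie, LieSubmodule.coe_bracket]

/-- The failure of `comparison s` to commute with vector fields on `1 ⊗ v`. -/
def comparisonDefect (s : V →ₗ[ℂ] Wh M a) (v : V) : SBar →ₗ[ℂ] M :=
  comparison s ∘ₗ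
      (LieModule.toEnd ℂ SBar (T a V) : SBar →ₗ[ℂ] Module.End ℂ (T a V)).flip (T.tmul a V 1 v)
    - (LieModule.toEnd ℂ SBar M : SBar →ₗ[ℂ] Module.End ℂ M).flip (s v : M)

theorem comparisonDefect_apply (v : V) (D : SBar) :
    comparisonDefect s v D = comparison s ⁅D, T.tmul a V 1 v⁆ - ⁅D, (s v : M)⁆ := rfl

theorem shiftedPartial_comparisonDefect (i : Fin 2) (v : V) (D : SBar) :
    shiftedPartial M a i (comparisonDefect s v D) = comparisonDefect s v ⁅partialS i, D⁆ := by
  rw [comparisonDefect_apply, comparisonDefect_apply, map_sub, ← comparison_shiftedPartial,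
    shiftedPartial_lie, shiftedPartial_lie, shiftedPartial_of_mem_Wh (tmul_one_mem_Wh v),
    shiftedPartial_of_mem_Wh (s v).2, lie_zero, lie_zero, add_zero, add_zero]

theorem IsASModule.comparisonDefect_eq_zero (hM : IsASModule M) (ht : IsOfType M a)
    (hι : ∀ v, toFiber M (s v) = ι v) (v : V) : comparisonDefect s v = 0 := by
  rw [← LinearMap.range_eq_bot]
  refine (hM.isNilpotentWeyl ht.exists_shiftedPartial_pow_eq_zero).eq_bot_of_le_iSup_range
    (fun i => ?_) ?_
  · rintro _ ⟨D, rfl⟩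
    exact ⟨⁅partialS i, D⁆, (shiftedPartial_comparisonDefect i v D).symm⟩
  · rw [← hM.originSubspace_eq_iSup_range]
    rintro _ ⟨D, rfl⟩
    refine (LieSubmodule.Quotient.mk_eq_zero (N := originSubmodule M)).mp ?_
    rw [comparisonDefect_apply]
    exact (map_sub (toFiber M) _ _).trans
      (sub_eq_zero.mpr (hM.toFiber_comparison_lie hι D v))

theorem IsASModule.comparison_lie (hM : IsASModule M) (ht : IsOfType M a)
    (hι : ∀ v, toFiber M (s v) = ι v) (x : STilde) (w : T a V) :
    comparison s ⁅x, w⁆ = ⁅x, comparison s w⁆ := by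
  rw [STilde_lie_eq, STilde_lie_eq, map_add, hM.comparison_polyAct, add_right_inj]
  induction w using T.induction with
  | zero => rw [lie_zero, map_zero, lie_zero]
  | add x y hx hy => rw [lie_add, map_add, map_add, lie_add, hx, hy]
  | tmul p v =>
    have htmul : T.tmul a V p v = polyAct (T a V) p (T.tmul a V 1 v) := by
      rw [polyAct_tmul, mul_one]
    have hone : comparison s ⁅x.right, T.tmul a V 1 v⁆ = ⁅x.right, (s v : M)⁆ :=
      sub_eq_zero.mp (LinearMap.congr_fun (hM.comparisonDefect_eq_zero ht hι v) x.right)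
    rw [htmul, lie_polyAct, map_add, hM.comparison_polyAct, hM.comparison_polyAct,
      hM.comparison_polyAct, lie_polyAct, hone, hM.comparison_tmul_one]

/-- The map `comparison s` as a homomorphism of `S̃₂`-modules. -/
def IsASModule.comparisonHom (hM : IsASModule M) (ht : IsOfType M a)
    (hι : ∀ v, toFiber M (s v) = ι v) : T a V →ₗ⁅ℂ,STilde⁆ M :=
  { comparison s with map_lie' := hM.comparison_lie ht hι _ _ }

theorem IsASModule.bijective_comparisonHom [Nontrivial V] [LieModule.IsIrreducible ℂ STilde M]
    (hM : IsASModule M) (ht : IsOfType M a) (hs : Function.Injective s)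
    (hι : ∀ v, toFiber M (s v) = ι v) : Function.Bijective (hM.comparisonHom ht hι) := by
  have hinj : Function.Injective (hM.comparisonHom ht hι) := hM.comparison_injective hs
  refine ⟨hinj, (LieModuleHom.range_eq_top _).mp <|
    (eq_bot_or_eq_top (hM.comparisonHom ht hι).range).resolve_left fun hbot => ?_⟩
  obtain ⟨v, hv⟩ := exists_ne (0 : V)
  have hmem : hM.comparisonHom ht hι (T.tmul a V 1 v) ∈ (hM.comparisonHom ht hι).range :=
    (LieModuleHom.mem_range _ _).mpr ⟨_, rfl⟩
  rw [hbot, LieSubmodule.mem_bot] at hmem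
  refine hv (hs ?_)
  rw [map_zero, ← ZeroMemClass.coe_eq_zero, ← hM.comparison_tmul_one]
  exact hmem

/-- The isomorphism of a simple module with `T(A₂ᵃ, V)` given by `comparison s`. -/
def IsASModule.comparisonEquiv [Nontrivial V] [LieModule.IsIrreducible ℂ STilde M]
    (hM : IsASModule M) (ht : IsOfType M a) (hs : Function.Injective s)
    (hι : ∀ v, toFiber M (s v) = ι v) : T a V ≃ₗ⁅ℂ,STilde⁆ M :=
  { hM.comparisonHom ht hι,
    LinearEquiv.ofBijective _ (hM.bijective_comparisonHom ht hs hι) with }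

end Comparison

theorem isIrreducible_of_isAtom {R L M : Type*} [CommRing R] [LieRing L] [AddCommGroup M]
    [Module R M] [LieRingModule L M] {U : LieSubmodule R L M} (hU : IsAtom U) :
    LieModule.IsIrreducible R L U := by
  have hmap := (LieSubmodule.mapOrderEmbedding U.injective_incl).injective
  have : Nontrivial U := (LieSubmodule.nontrivial_iff_ne_bot R L M).mpr hU.1
  refine LieModule.IsIrreducible.mk fun N hN => hmap ?_
  calc N.map U.incl = U :=
        (hU.le_iff.mp LieSubmodule.map_incl_le).resolve_left fun h =>
          hN (hmap (h.trans LieSubmodule.map_bot.symm))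
    _ = (⊤ : LieSubmodule R L U).map U.incl := U.map_incl_top.symm

end CartanS

end

theorem corollary3 (a : Fin 2 → ℂ) (M : Type u)
    [AddCommGroup M] [Module ℂ M] [LieRingModule CartanS.STilde M] [LieModule ℂ CartanS.STilde M]
    (hAS : CartanS.IsASModule M)
    (hsimple : LieModule.IsIrreducible ℂ CartanS.STilde M)
    (hWhittaker : CartanS.IsWhittaker M)
    (htype : CartanS.IsOfType M a)
    (hfin : FiniteDimensional ℂ (CartanS.Wh M a)) :
    ∃ (V : Type u) (_ : AddCommGroup V) (_ : Module ℂ V)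
      (_ : LieRingModule CartanS.gl₂ V) (_ : LieModule ℂ CartanS.gl₂ V),
      FiniteDimensional ℂ V ∧ LieModule.IsIrreducible ℂ CartanS.gl₂ V ∧
        Nonempty (M ≃ₗ⁅ℂ, CartanS.STilde⁆ CartanS.T a V) := by
  open CartanS in
  have : Nontrivial M := LieModule.nontrivial_of_isIrreducible ℂ STilde M
  have : Nontrivial (OriginFiber M) := hAS.nontrivial_fiber htype
  have : FiniteDimensional ℂ (OriginFiber M) := (hAS.fiberEquivWh htype).symm.finiteDimensional
  obtain ⟨U, hU, hle⟩ :=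
    (eq_bot_or_exists_atom_le (higherInvariants M)).resolve_left higherInvariants_ne_bot
  have hirr : LieModule.IsIrreducible ℂ gl₂ U := isIrreducible_of_isAtom hU
  have : Nontrivial U := LieModule.nontrivial_of_isIrreducible ℂ gl₂ U
  let s : U →ₗ[ℂ] Wh M a := (hAS.fiberEquivWh htype).toLinearMap ∘ₗ U.incl
  have hs : Function.Injective s := (hAS.fiberEquivWh htype).injective.comp U.injective_incl
  have hι (v : U) : toFiber M (s v) = LieSubmodule.inclusion hle v :=
    hAS.toFiber_fiberEquivWh htype v
  exact ⟨U, inferInstance, inferInstance, inferInstance, inferInstance, inferInstance, hirr,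
    ⟨(hAS.comparisonEquiv htype hs hι).symm⟩⟩
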